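/- Let $E=\bigwedge_{\mathbb C}\langle e_1,\ldots,e_n\rangle$ be the exterior algebra over $\mathbb C$ on $n$ variables, and let $G$ be a graph with vertex set $\{1,\ldots,n\}$ which, up to isomorphism, is one of the following three graphs: (1) the disjoint union of two triangles and $n-6$ isolated vertices ($n\ge 6$); (2) the disjoint union of a triangle, a path on four vertices and $n-7$ isolated vertices ($n\ge 7$); (3) the disjoint union of two paths on four vertices and $n-8$ isolated vertices ($n\ge 8$). Let $I_E(G)\subseteq E$ be the ideal generated by the monomials $e_ie_j$ with $\{i,j\}$ an edge of $G$. A monomial order on $E$ is a total order $<$ on the monomials $e_{i_1}\cdots e_{i_t}$ ($i_1<\cdots<i_t$) such that $1<u$ for every monomial $u\neq 1$, and such that, whenever $u<v$ and $w$ is a monomial with $uw\neq 0\neq vw$, one has $uw<vw$ (up to sign). The initial ideal $in_<(I)$ of an ideal $I$ is the ideal generated by the leading terms of the nonzero elements of $I$. A quadric $q\in E_2$ can be written uniquely as $q=\sum_{i,j}A_{ij}\,e_ie_j$ with $A$ an alternating complex $n\times n$ matrix; the rank of $q$ is the rank of $A$. If $I\subseteq E$ is a graded ideal and $<$ is a monomial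 order on $E$ such that $in_<(I)=I_E(G)$, then $I$ contains a quadric of rank $2$. -/

import Mathlib

noncomputable section

namespace ExtEdge

open scoped Matrix

/-- The exterior algebra over `ℂ` on `n` variables. -/
abbrev E (n : ℕ) : Type := ExteriorAlgebra ℂ (Fin n → ℂ)

/-- The variable `e i`, a standard basis vector in degree one. -/
def e {n : ℕ} (i : Fin n) : E n := ExteriorAlgebra.ι ℂ (Pi.single i 1)

/-- The basis of the exterior algebra consisting of the monomials. The monomial indexed by
`S = {i₁ < ⋯ < i_t}` is `e i₁ * ⋯ * e i_t`. -/
def monomialBasis (n : ℕ) : Module.Basis (Finset (Fin n)) ℂ (E n) :=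
  (Pi.basisFun ℂ (Fin n)).ExteriorAlgebra

/-- A monomial order on the exterior algebra, as a relation on the index sets of the monomials:
a strict total order for which `1` is the smallest monomial and which is preserved by
multiplication with a monomial as long as both products are nonzero. -/
structure IsMonomialOrder {n : ℕ} (lt : Finset (Fin n) → Finset (Fin n) → Prop) : Prop where
  irrefl : ∀ S, ¬ lt S S
  trans : ∀ S T U, lt S T → lt T U → lt S U
  total : ∀ S T, S ≠ T → lt S T ∨ lt T S
  one_lt : ∀ S, S ≠ ∅ → lt ∅ S
  mul_lt_mul : ∀ S T U, lt S T → Disjoint S U → Disjoint T U → lt (S ∪ U) (T ∪ U)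

/-- The support of `f`: the monomials that occur in `f` with a nonzero coefficient. -/
def supp {n : ℕ} (f : E n) : Finset (Finset (Fin n)) := ((monomialBasis n).repr f).support

/-- `t` is the leading term (with its coefficient) of `f`. No `t` has this property if `f = 0`. -/
def IsLeadingTerm {n : ℕ} (lt : Finset (Fin n) → Finset (Fin n) → Prop) (f t : E n) : Prop :=
  ∃ S ∈ supp f, (∀ T ∈ supp f, T ≠ S → lt T S) ∧
    t = (monomialBasis n).repr f S • monomialBasis n S

/-- The initial ideal of `I`, generated by the leading terms of the elements of `I`. (`Ideal` is
Mathlib's type of left ideals; left ideals generated by homogeneous elements of the exterior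
algebra are two-sided.) -/
def initialIdeal {n : ℕ} (lt : Finset (Fin n) → Finset (Fin n) → Prop) (I : Ideal (E n)) :
    Ideal (E n) :=
  Ideal.span {t | ∃ f ∈ I, IsLeadingTerm lt f t}

/-- The exterior edge ideal of a graph. -/
def edgeIdeal {n : ℕ} (G : SimpleGraph (Fin n)) : Ideal (E n) :=
  Ideal.span {m | ∃ i j, G.Adj i j ∧ m = e i * e j}

/-- `I` is a graded ideal of the exterior algebra with its standard grading. -/
def IsGraded {n : ℕ} (I : Ideal (E n)) : Prop :=
  I.IsHomogeneous (fun d : ℕ => ⋀[ℂ]^d (Fin n → ℂ))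

/-- A quadric is a homogeneous element of degree two. -/
def IsQuadric {n : ℕ} (q : E n) : Prop := q ∈ ⋀[ℂ]^2 (Fin n → ℂ)

/-- The quadric `q` has rank `r`: its (unique) alternating matrix `A`, for which
`q = ∑ A i j • e i * e j`, has rank `r`. -/
def HasRank {n : ℕ} (q : E n) (r : ℕ) : Prop :=
  ∃ A : Matrix (Fin n) (Fin n) ℂ, (Aᵀ = -A ∧ ∀ i, A i i = 0) ∧
    q = ∑ i, ∑ j, A i j • (e i * e j) ∧ A.rank = r

/-- Two disjoint triangles and `m` isolated vertices. -/
def graph1 (m : ℕ) : SimpleGraph ((Fin 3 ⊕ Fin 3) ⊕ Fin m) :=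
  (SimpleGraph.cycleGraph 3 ⊕g SimpleGraph.cycleGraph 3) ⊕g (⊥ : SimpleGraph (Fin m))

/-- A triangle, a path on four vertices and `m` isolated vertices, all disjoint. -/
def graph2 (m : ℕ) : SimpleGraph ((Fin 3 ⊕ Fin 4) ⊕ Fin m) :=
  (SimpleGraph.cycleGraph 3 ⊕g SimpleGraph.pathGraph 4) ⊕g (⊥ : SimpleGraph (Fin m))

/-- Two disjoint paths on four vertices and `m` isolated vertices. -/
def graph3 (m : ℕ) : SimpleGraph ((Fin 4 ⊕ Fin 4) ⊕ Fin m) :=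
  (SimpleGraph.pathGraph 4 ⊕g SimpleGraph.pathGraph 4) ⊕g (⊥ : SimpleGraph (Fin m))

/-- `G` is, up to the labelling of its vertices, one of the three graphs above. -/
def IsOneOfThree {n : ℕ} (G : SimpleGraph (Fin n)) : Prop :=
  (∃ m, Nonempty (G ≃g graph1 m)) ∨ (∃ m, Nonempty (G ≃g graph2 m)) ∨
    (∃ m, Nonempty (G ≃g graph3 m))

end ExtEdge

end

/-!
Only two features of `G` matter: it has an edge, and every vertex has at most two neighbours. The
quadric of rank two is found as a nonzero product of two linear forms.

From the hypothesis on the initial ideal come two facts. The monomials outside the edge ideal, that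
is, those indexed by independent sets, are linearly independent modulo `I`
(`eq_zero_of_mem_of_indep`); and for every edge `i j` there is a reduced quadric in `I`, the sum of
`e i * e j` and a combination of smaller non-edges (`exists_reduced_quadric`).

Let `a` be the non-isolated vertex whose variable is smallest, and let `b < c` be its neighbours.
A variable that is multiplied with `e b` or `e c` in the reduced quadric of `a b` is smaller than
`e a`, so it belongs to an isolated vertex. Hence completing the square gives `q = x * y + m * e c
+ s` with `x = e a - v` and `y = e b + ⋯`, where `v` and `m` are linear forms in isolated
variables and `s` is a combination of non-edges that avoid `a`, `b` and `c`. Multiplication by an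
isolated variable preserves independent sets. If `q'` is the reduced quadric of `a c`, it follows
that `x * q + m * q'` lies in `I` and is a combination of independent sets, so it is zero.
Comparing the parts with and without `e a` yields `q = x * y + m * z` and `q' = x * z + m * r`
with `z = e c + ⋯`. The same independence argument, applied to `x * m * r₀` with `r₀` the part of
`r` complementary to `y` and `z`, shows that `r` may be taken in the span of `x, y, z, m`. Then
`q' + L * q` is a product of linear forms as soon as `L` is a root of a certain quadratic
polynomial, which exists over `ℂ`; in the case `m = 0` already `q = x * y`
(`exists_product_of_two_neighbors`). If `a` has a single neighbour, then also `q = x * y`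
(`exists_product_of_one_neighbor`).
-/

noncomputable section

namespace ExtEdge

open scoped Matrix

variable {n : ℕ}

/-! ### Products of monomials and spans of monomials -/

lemma monomialBasis_mul_of_disjoint {S T : Finset (Fin n)} (h : Disjoint S T) :
    ∃ c : ℂ, c ≠ 0 ∧
      monomialBasis n S * monomialBasis n T = c • monomialBasis n (S ∪ T) := by
  have h' : Disjoint (Set.powersetCard.ofCard (n := S.card) (s := S) rfl).val
      (Set.powersetCard.ofCard (n := T.card) (s := T) rfl).val := h
  have key := ExteriorAlgebra.basis_mul_of_disjoint (Pi.basisFun ℂ (Fin n)) _ _ h'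
  rw [show ((Set.powersetCard.disjUnion h' : Set.powersetCard (Fin n) _) : Finset (Fin n)) = S ∪ T
    from Finset.disjUnion_eq_union S T h] at key
  rcases Int.units_eq_one_or (Set.powersetCard.permOfDisjoint h').sign with hs | hs <;>
    rw [hs] at key
  · exact ⟨1, one_ne_zero, by rw [one_smul]; rw [one_smul] at key; exact key⟩
  · refine ⟨-1, by simp, ?_⟩
    rw [neg_one_smul]
    rw [Units.neg_smul, one_smul] at key
    exact key

lemma monomialBasis_mul_of_not_disjoint {S T : Finset (Fin n)} (h : ¬ Disjoint S T) :
    monomialBasis n S * monomialBasis n T = 0 := by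
  have h' : ¬ Disjoint (Set.powersetCard.ofCard (n := S.card) (s := S) rfl).val
      (Set.powersetCard.ofCard (n := T.card) (s := T) rfl).val := h
  have key := ExteriorAlgebra.basis_mul_of_not_disjoint (Pi.basisFun ℂ (Fin n)) _ _ h'
  exact key

lemma monomialBasis_singleton (i : Fin n) : monomialBasis n {i} = e i := by
  rw [monomialBasis, ExteriorAlgebra.basis_apply_ofCard _ (n := 1) (by simp)]
  simp only [ExteriorAlgebra.ιMulti_family, e, ExteriorAlgebra.ιMulti_succ_apply,
    ExteriorAlgebra.ιMulti_zero_apply, mul_one, Function.comp_apply, Pi.basisFun_apply,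
    Set.powersetCard.ofFinEmbEquiv_symm_apply]
  congr 2
  exact Finset.mem_singleton.mp (Finset.orderEmbOfFin_mem ({i} : Finset (Fin n)) (by simp) 0)

lemma monomialBasis_mem_exteriorPower (S : Finset (Fin n)) :
    monomialBasis n S ∈ ⋀[ℂ]^S.card (Fin n → ℂ) := by
  have h := ExteriorAlgebra.basis_eq_coe_basis (Pi.basisFun ℂ (Fin n))
    (Set.powersetCard.ofCard (n := S.card) (s := S) rfl)
  change (Pi.basisFun ℂ (Fin n)).ExteriorAlgebra
    ((Set.powersetCard.ofCard (n := S.card) (s := S) rfl : Set.powersetCard (Fin n) S.card) :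
      Finset (Fin n)) ∈ _
  rw [h]
  exact Submodule.coe_mem _

/-- The elements of the exterior algebra all of whose monomials are indexed by members of `U`. -/
def monomialSpan (U : Set (Finset (Fin n))) : Submodule ℂ (E n) :=
  Submodule.span ℂ (monomialBasis n '' U)

lemma mem_monomialSpan {U : Set (Finset (Fin n))} {f : E n} :
    f ∈ monomialSpan U ↔ ∀ S ∈ supp f, S ∈ U := by
  rw [monomialSpan, Module.Basis.mem_span_image]
  rfl

lemma mem_supp {f : E n} {S : Finset (Fin n)} :
    S ∈ supp f ↔ (monomialBasis n).repr f S ≠ 0 := Finsupp.mem_support_iff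

lemma monomialBasis_mem_monomialSpan {U : Set (Finset (Fin n))} {S : Finset (Fin n)} (hS : S ∈ U) :
    monomialBasis n S ∈ monomialSpan U :=
  Submodule.subset_span ⟨S, hS, rfl⟩

lemma monomialBasis_mul_mem {U : Set (Finset (Fin n))} {S T : Finset (Fin n)}
    (h : Disjoint S T → S ∪ T ∈ U) : monomialBasis n S * monomialBasis n T ∈ monomialSpan U := by
  by_cases hd : Disjoint S T
  · obtain ⟨c, -, hc⟩ := monomialBasis_mul_of_disjoint hd
    rw [hc]
    exact Submodule.smul_mem _ _ (monomialBasis_mem_monomialSpan (h hd))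
  · rw [monomialBasis_mul_of_not_disjoint hd]
    exact zero_mem _

/-- The span of an upward closed set of monomials is an ideal. -/
lemma mul_mem_monomialSpan {U : Set (Finset (Fin n))} (hU : IsUpperSet U) (g : E n) {f : E n}
    (hf : f ∈ monomialSpan U) : g * f ∈ monomialSpan U := by
  induction hf using Submodule.span_induction with
  | zero => rw [mul_zero]; exact zero_mem _
  | add x y _ _ hx hy => rw [mul_add]; exact add_mem hx hy
  | smul c x _ hx => rw [mul_smul_comm]; exact Submodule.smul_mem _ _ hx
  | mem x hx =>
    obtain ⟨T, hT, rfl⟩ := hx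
    induction (monomialBasis n).mem_span g using Submodule.span_induction with
    | zero => rw [zero_mul]; exact zero_mem _
    | add x y _ _ hx hy => rw [add_mul]; exact add_mem hx hy
    | smul c x _ hx => rw [smul_mul_assoc]; exact Submodule.smul_mem _ _ hx
    | mem x hx =>
      obtain ⟨S, rfl⟩ := hx
      exact monomialBasis_mul_mem fun _ => hU Finset.subset_union_right hT

lemma mem_monomialSpan_of_mem_idealSpan {U : Set (Finset (Fin n))} (hU : IsUpperSet U)
    {A : Set (E n)} (hA : ∀ a ∈ A, a ∈ monomialSpan U) {f : E n} (hf : f ∈ Ideal.span A) :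
    f ∈ monomialSpan U := by
  induction hf using Submodule.span_induction with
  | zero => exact zero_mem _
  | add x y _ _ hx hy => exact add_mem hx hy
  | smul c x _ hx => exact mul_mem_monomialSpan hU c hx
  | mem x hx => exact hA x hx

lemma e_mul_e {i j : Fin n} (hij : i ≠ j) :
    ∃ c : ℂ, c ≠ 0 ∧ e i * e j = c • monomialBasis n {i, j} := by
  rw [← monomialBasis_singleton, ← monomialBasis_singleton]
  exact monomialBasis_mul_of_disjoint (by simpa using hij)

lemma e_mul_self (i : Fin n) : e i * e i = 0 := ExteriorAlgebra.ι_sq_zero _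

lemma e_mul_swap (i j : Fin n) : e i * e j = -(e j * e i) :=
  eq_neg_of_add_eq_zero_left (ExteriorAlgebra.ι_add_mul_swap _ _)

lemma ι_mul_swap (x y : Fin n → ℂ) : ExteriorAlgebra.ι ℂ x * ExteriorAlgebra.ι ℂ y =
    -(ExteriorAlgebra.ι ℂ y * ExteriorAlgebra.ι ℂ x) :=
  eq_neg_of_add_eq_zero_left (ExteriorAlgebra.ι_add_mul_swap _ _)

/-! ### Reduced quadrics -/

section Groebner

variable {lt : Finset (Fin n) → Finset (Fin n) → Prop} {G : SimpleGraph (Fin n)} {I : Ideal (E n)}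

lemma IsMonomialOrder.wellFounded (hlt : IsMonomialOrder lt) : WellFounded lt := by
  have : IsTrans _ lt := ⟨hlt.trans⟩
  have : Std.Irrefl lt := ⟨hlt.irrefl⟩
  exact Finite.wellFounded_of_trans_of_irrefl lt

lemma IsMonomialOrder.exists_max (hlt : IsMonomialOrder lt) {A : Finset (Finset (Fin n))}
    (hA : A.Nonempty) : ∃ S ∈ A, ∀ T ∈ A, T ≠ S → lt T S := by
  have : IsTrans _ (flip lt) := ⟨fun a b c h1 h2 => hlt.trans _ _ _ h2 h1⟩
  have : Std.Irrefl (flip lt) := ⟨hlt.irrefl⟩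
  have wf := Finite.wellFounded_of_trans_of_irrefl (flip lt)
  obtain ⟨S, hS, hmax⟩ := wf.has_min (A : Set (Finset (Fin n))) hA
  refine ⟨S, hS, fun T hT hne => (hlt.total T S hne).resolve_right (hmax T hT)⟩

/-- The independent sets of vertices of `G`; they index the monomials outside the edge ideal. -/
def indepSets (G : SimpleGraph (Fin n)) : Set (Finset (Fin n)) :=
  {S | ∀ i ∈ S, ∀ j ∈ S, ¬ G.Adj i j}

lemma isUpperSet_compl_indepSets : IsUpperSet (indepSets G)ᶜ := by
  intro S T hST hS hT
  exact hS fun i hi j hj => hT i (hST hi) j (hST hj)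

lemma mem_monomialSpan_of_mem_edgeIdeal {f : E n} (hf : f ∈ edgeIdeal G) :
    f ∈ monomialSpan (indepSets G)ᶜ := by
  refine mem_monomialSpan_of_mem_idealSpan isUpperSet_compl_indepSets ?_ hf
  rintro _ ⟨i, j, hij, rfl⟩
  obtain ⟨c, -, hc⟩ := e_mul_e hij.ne
  rw [hc]
  refine Submodule.smul_mem _ _ (monomialBasis_mem_monomialSpan fun h => ?_)
  exact h i (by simp) j (by simp) hij

/-- The largest monomial of a nonzero element of `I` is divisible by an edge. -/
lemma leading_not_indep (hin : initialIdeal lt I = edgeIdeal G) {f : E n} (hf : f ∈ I)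
    {S : Finset (Fin n)} (hS : S ∈ supp f) (hmax : ∀ T ∈ supp f, T ≠ S → lt T S) :
    S ∉ indepSets G := by
  have h1 : (monomialBasis n).repr f S • monomialBasis n S ∈ edgeIdeal G := by
    rw [← hin]
    exact Ideal.subset_span ⟨f, hf, S, hS, hmax, rfl⟩
  refine mem_monomialSpan.mp (mem_monomialSpan_of_mem_edgeIdeal h1) S ?_
  rw [mem_supp] at hS ⊢
  simpa using hS

/-- The standard monomials are linearly independent modulo `I`. -/
lemma eq_zero_of_mem_of_indep (hlt : IsMonomialOrder lt) (hin : initialIdeal lt I = edgeIdeal G)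
    {f : E n} (hf : f ∈ I) (hN : f ∈ monomialSpan (indepSets G)) : f = 0 := by
  by_contra hne
  have hsupp : (supp f).Nonempty := by
    rw [supp, Finsupp.support_nonempty_iff]
    simpa using hne
  obtain ⟨S, hS, hmax⟩ := hlt.exists_max hsupp
  exact leading_not_indep hin hf hS hmax (mem_monomialSpan.mp hN S hS)

lemma exists_leading (hin : initialIdeal lt I = edgeIdeal G) {i j : Fin n} (hij : G.Adj i j) :
    ∃ f ∈ I, {i, j} ∈ supp f ∧ ∀ T ∈ supp f, T ≠ {i, j} → lt T {i, j} := by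
  have h1 : e i * e j ∈ initialIdeal lt I := by
    rw [hin]
    exact Ideal.subset_span ⟨i, j, hij, rfl⟩
  let U : Set (Finset (Fin n)) :=
    {T | ∃ f ∈ I, ∃ S ∈ supp f, (∀ T ∈ supp f, T ≠ S → lt T S) ∧ S ⊆ T}
  have h2 : e i * e j ∈ monomialSpan U := by
    refine mem_monomialSpan_of_mem_idealSpan ?_ ?_ h1
    · rintro T T' hTT' ⟨f, hf, S, hS, hmax, hST⟩
      exact ⟨f, hf, S, hS, hmax, hST.trans hTT'⟩
    · rintro _ ⟨f, hf, S, hS, hmax, rfl⟩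
      exact Submodule.smul_mem _ _
        (monomialBasis_mem_monomialSpan ⟨f, hf, S, hS, hmax, subset_rfl⟩)
  obtain ⟨c, hc, hce⟩ := e_mul_e hij.ne
  obtain ⟨f, hf, S, hS, hmax, hST⟩ := mem_monomialSpan.mp h2 {i, j} (by
    rw [mem_supp, hce]; simpa using hc)
  -- The leading monomial `S` divides `e i * e j` and is itself divisible by an edge.
  have hSe : S = {i, j} := by
    refine Finset.Subset.antisymm hST ?_
    have := leading_not_indep hin hf hS hmax
    simp only [indepSets, Set.mem_ofPred_eq, not_forall, not_not] at this
    obtain ⟨k, hk, l, hl, hkl⟩ := this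
    have hk' := hST hk
    have hl' := hST hl
    simp only [Finset.mem_insert, Finset.mem_singleton] at hk' hl'
    have := hkl.ne
    intro x hx
    simp only [Finset.mem_insert, Finset.mem_singleton] at hx
    grind
  subst hSe
  exact ⟨f, hf, hS, hmax⟩

lemma repr_proj_two (f : E n) (T : Finset (Fin n)) :
    (monomialBasis n).repr (GradedRing.proj (fun d : ℕ => ⋀[ℂ]^d (Fin n → ℂ)) 2 f) T =
      if T.card = 2 then (monomialBasis n).repr f T else 0 := by
  have key : ∀ (c : ℂ) (S : Finset (Fin n)),
      GradedRing.proj (fun d : ℕ => ⋀[ℂ]^d (Fin n → ℂ)) 2 (c • monomialBasis n S) =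
        if S.card = 2 then c • monomialBasis n S else 0 := by
    intro c S
    have hmem := Submodule.smul_mem _ c (monomialBasis_mem_exteriorPower S)
    rw [GradedRing.proj_apply]
    split_ifs with hS
    · exact DirectSum.decompose_of_mem_same _ (hS ▸ hmem)
    · exact DirectSum.decompose_of_mem_ne _ hmem hS
  conv_lhs => rw [← (monomialBasis n).sum_repr f, map_sum]
  simp_rw [key]
  rw [map_sum, Finsupp.finsetSum_apply, Finset.sum_eq_single T]
  · split_ifs <;> simp
  · intro S _ hST
    split_ifs <;> simp [Finsupp.single_eq_of_ne' hST]
  · simp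

/-- The monomials of degree two that are not edges and are smaller than `S`. -/
def smallNonedges (G : SimpleGraph (Fin n)) (lt : Finset (Fin n) → Finset (Fin n) → Prop)
    (S : Finset (Fin n)) : Set (Finset (Fin n)) :=
  {T | T.card = 2 ∧ T ∈ indepSets G ∧ lt T S}

/-- The reduced Gröbner basis of `I`, in degree two. -/
lemma exists_reduced (hlt : IsMonomialOrder lt) (hI : IsGraded I)
    (hin : initialIdeal lt I = edgeIdeal G) (S : Finset (Fin n)) :
    (∃ i j, G.Adj i j ∧ S = {i, j}) →
      ∃ q ∈ I, q - monomialBasis n S ∈ monomialSpan (smallNonedges G lt S) := by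
  classical
  induction S using hlt.wellFounded.induction with
  | _ S ih =>
  rintro ⟨i, j, hij, rfl⟩
  obtain ⟨f, hf, hS, hmax⟩ := exists_leading hin hij
  have hcard : ({i, j} : Finset (Fin n)).card = 2 := Finset.card_pair hij.ne
  set S : Finset (Fin n) := {i, j} with hSdef
  -- The normalized component of degree two of `f`.
  set p : E n := ((monomialBasis n).repr f S)⁻¹ •
    GradedRing.proj (fun d : ℕ => ⋀[ℂ]^d (Fin n → ℂ)) 2 f with hp
  have hpI : p ∈ I := by
    rw [hp, Algebra.smul_def]
    exact I.mul_mem_left _ (hI 2 hf)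
  have hprepr : ∀ T, (monomialBasis n).repr p T =
      ((monomialBasis n).repr f S)⁻¹ * if T.card = 2 then (monomialBasis n).repr f T else 0 := by
    intro T
    rw [hp, map_smul, Finsupp.smul_apply, repr_proj_two, smul_eq_mul]
  have hpS : (monomialBasis n).repr p S = 1 := by
    rw [hprepr, if_pos hcard, inv_mul_cancel₀ (mem_supp.mp hS)]
  have hpT : ∀ T, T ≠ S → (monomialBasis n).repr p T ≠ 0 → T.card = 2 ∧ lt T S := by
    intro T hTS hT
    rw [hprepr] at hT
    split_ifs at hT with h2
    · exact ⟨h2, hmax T (mem_supp.mpr (right_ne_zero_of_mul hT)) hTS⟩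
    · simp at hT
  choose! r hrI hr using ih
  let A : Finset (Finset (Fin n)) :=
    Finset.univ.filter fun T => lt T S ∧ ∃ i j, G.Adj i j ∧ T = {i, j}
  refine ⟨p - ∑ T ∈ A, (monomialBasis n).repr p T • r T, ?_, ?_⟩
  · refine sub_mem hpI (sum_mem fun T hT => ?_)
    rw [Algebra.smul_def]
    simp only [A, Finset.mem_filter, Finset.mem_univ, true_and] at hT
    exact I.mul_mem_left _ (hrI T hT.1 hT.2)
  -- Write `p = S + (edges below S) + (other monomials)` and reduce each edge.
  have hdecomp : p - ∑ T ∈ A, (monomialBasis n).repr p T • r T - monomialBasis n S =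
      (p - monomialBasis n S - ∑ T ∈ A, (monomialBasis n).repr p T • monomialBasis n T) -
      ∑ T ∈ A, (monomialBasis n).repr p T • (r T - monomialBasis n T) := by
    simp only [smul_sub, Finset.sum_sub_distrib]
    abel
  rw [hdecomp]
  refine sub_mem ?_ (sum_mem fun T hT => Submodule.smul_mem _ _ ?_)
  · rw [mem_monomialSpan]
    intro T hT
    rw [mem_supp, map_sub, map_sub, map_sum, Finsupp.sub_apply, Finsupp.sub_apply,
      Finsupp.finsetSum_apply] at hT
    simp only [map_smul, Module.Basis.repr_self, Finsupp.smul_apply, Finsupp.single_apply,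
      smul_eq_mul, mul_ite, mul_one, mul_zero, Finset.sum_ite_eq'] at hT
    have hTS : T ≠ S := by
      rintro rfl
      refine hT ?_
      rw [if_pos rfl, if_neg, hpS]
      · simp
      · simp only [A, Finset.mem_filter, Finset.mem_univ, true_and, not_and]
        exact fun h => (hlt.irrefl _ h).elim
    rw [if_neg (Ne.symm hTS), sub_zero] at hT
    by_cases hTA : T ∈ A
    · rw [if_pos hTA, sub_self] at hT
      exact (hT rfl).elim
    rw [if_neg hTA, sub_zero] at hT
    obtain ⟨h2, hlt'⟩ := hpT T hTS hT
    refine ⟨h2, fun k hk l hl hkl => hTA ?_, hlt'⟩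
    simp only [A, Finset.mem_filter, Finset.mem_univ, true_and]
    refine ⟨hlt', k, l, hkl, (Finset.eq_of_subset_of_card_le ?_ ?_).symm⟩
    · intro x hx
      simp only [Finset.mem_insert, Finset.mem_singleton] at hx
      rcases hx with rfl | rfl <;> assumption
    · rw [h2, Finset.card_pair hkl.ne]
  · simp only [A, Finset.mem_filter, Finset.mem_univ, true_and] at hT
    have := mem_monomialSpan.mp (hr T hT.1 hT.2)
    rw [mem_monomialSpan]
    exact fun U hU => ⟨(this U hU).1, (this U hU).2.1, hlt.trans _ _ _ (this U hU).2.2 hT.1⟩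

/-- For an edge `i j`, the ideal contains a quadric `e i * e j + t` with `t` a combination of
products of two variables that are not edges and are smaller than `e i * e j`. -/
lemma exists_reduced_quadric (hlt : IsMonomialOrder lt) (hI : IsGraded I)
    (hin : initialIdeal lt I = edgeIdeal G) {i j : Fin n} (hij : G.Adj i j) :
    ∃ t ∈ Submodule.span ℂ {x : E n | ∃ k l, k ≠ l ∧ ¬ G.Adj k l ∧ lt {k, l} {i, j} ∧
      x = e k * e l}, e i * e j + t ∈ I := by
  obtain ⟨q, hq, hqt⟩ := exists_reduced hlt hI hin {i, j} ⟨i, j, hij, rfl⟩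
  obtain ⟨c, hc, hce⟩ := e_mul_e hij.ne
  refine ⟨c • (q - monomialBasis n {i, j}), Submodule.smul_mem _ _ ?_, ?_⟩
  · refine Submodule.span_le.mpr ?_ hqt
    rintro _ ⟨T, ⟨h2, hT, hTlt⟩, rfl⟩
    obtain ⟨k, l, hkl, rfl⟩ := Finset.card_eq_two.mp h2
    obtain ⟨c', hc', hce'⟩ := e_mul_e hkl
    have : monomialBasis n {k, l} = c'⁻¹ • (e k * e l) := by
      rw [hce', smul_smul, inv_mul_cancel₀ hc', one_smul]
    rw [SetLike.mem_coe, this]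
    exact Submodule.smul_mem _ _
      (Submodule.subset_span ⟨k, l, hkl, hT k (by simp) l (by simp), hTlt, rfl⟩)
  · rw [hce, ← smul_add, add_sub_cancel, Algebra.smul_def]
    exact I.mul_mem_left _ hq

lemma e_mul_e_mul_e_mem_indep {k l m : Fin n} (h1 : ¬ G.Adj k l) (h2 : ¬ G.Adj k m)
    (h3 : ¬ G.Adj l m) : e k * (e l * e m) ∈ monomialSpan (indepSets G) := by
  by_cases hlm : l = m
  · rw [hlm, e_mul_self, mul_zero]
    exact zero_mem _
  obtain ⟨c, -, hc⟩ := e_mul_e hlm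
  rw [hc, mul_smul_comm, ← monomialBasis_singleton]
  refine Submodule.smul_mem _ _ (monomialBasis_mul_mem fun _ => ?_)
  have h1' : ¬ G.Adj l k := fun h => h1 h.symm
  have h2' : ¬ G.Adj m k := fun h => h2 h.symm
  have h3' : ¬ G.Adj m l := fun h => h3 h.symm
  simp [indepSets, h1, h2, h3, h1', h2', h3']

end Groebner

open ExteriorAlgebra (ι)

/-! ### Linear forms and contractions -/

/-- The linear forms in the variables `e i` with `P i`. -/
def linearSpan (P : Fin n → Prop) : Submodule ℂ (E n) :=
  Submodule.span ℂ (e '' {i | P i})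

lemma e_mem_linearSpan {P : Fin n → Prop} {i : Fin n} (h : P i) : e i ∈ linearSpan P :=
  Submodule.subset_span ⟨i, h, rfl⟩

lemma exists_ι_of_mem_linearSpan {P : Fin n → Prop} {f : E n} (hf : f ∈ linearSpan P) :
    ∃ x : Fin n → ℂ, f = ι ℂ x ∧ ∀ i, ¬ P i → x i = 0 := by
  induction hf using Submodule.span_induction with
  | zero => exact ⟨0, by simp, by simp⟩
  | add f g _ _ hf hg =>
    obtain ⟨x, rfl, hx⟩ := hf
    obtain ⟨y, rfl, hy⟩ := hg
    exact ⟨x + y, by simp, fun i hi => by simp [hx i hi, hy i hi]⟩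
  | smul c f _ hf =>
    obtain ⟨x, rfl, hx⟩ := hf
    exact ⟨c • x, by simp, fun i hi => by simp [hx i hi]⟩
  | mem f hf =>
    obtain ⟨j, hj, rfl⟩ := hf
    exact ⟨Pi.single j 1, rfl, fun i hi => Pi.single_eq_of_ne (by rintro rfl; exact hi hj) _⟩

lemma ι_mem_linearSpan {P : Fin n → Prop} {x : Fin n → ℂ} (hx : ∀ i, ¬ P i → x i = 0) :
    ι ℂ x ∈ linearSpan P := by
  rw [pi_eq_sum_univ' x, map_sum]
  refine sum_mem fun i _ => ?_
  rw [map_smul]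
  by_cases hi : P i
  · refine Submodule.smul_mem _ _ ?_
    convert e_mem_linearSpan hi
    rw [e]
  · rw [hx i hi, zero_smul]
    exact zero_mem _

lemma mul_mem_of_mem_span {A B : Set (E n)} {W : Submodule ℂ (E n)} {x y : E n}
    (hx : x ∈ Submodule.span ℂ A) (hy : y ∈ Submodule.span ℂ B)
    (h : ∀ a ∈ A, ∀ b ∈ B, a * b ∈ W) : x * y ∈ W := by
  have := Submodule.mul_mem_mul hx hy
  rw [Submodule.span_mul_span] at this
  refine Submodule.span_le.mpr ?_ this
  rintro _ ⟨a, ha, b, hb, rfl⟩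
  exact h a ha b hb

lemma mul_mul_mem_of_mem_span {A B C : Set (E n)} {W : Submodule ℂ (E n)} {x y z : E n}
    (hx : x ∈ Submodule.span ℂ A) (hy : y ∈ Submodule.span ℂ B) (hz : z ∈ Submodule.span ℂ C)
    (h : ∀ a ∈ A, ∀ b ∈ B, ∀ c ∈ C, a * (b * c) ∈ W) : x * (y * z) ∈ W := by
  have hyz := Submodule.mul_mem_mul hy hz
  rw [Submodule.span_mul_span] at hyz
  refine mul_mem_of_mem_span hx hyz ?_
  rintro a ha _ ⟨b, hb, c, hc, rfl⟩
  exact h a ha b hb c hc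

/-- Contraction of an element of the exterior algebra with a linear functional. -/
def contract (δ : Module.Dual ℂ (Fin n → ℂ)) : E n →ₗ[ℂ] E n :=
  CliffordAlgebra.contractLeft (Q := (0 : QuadraticForm ℂ (Fin n → ℂ))) δ

lemma contract_ι_mul (δ : Module.Dual ℂ (Fin n → ℂ)) (x : Fin n → ℂ) (f : E n) :
    contract δ (ι ℂ x * f) = δ x • f - ι ℂ x * contract δ f :=
  CliffordAlgebra.contractLeft_ι_mul _ _ _

lemma contract_ι (δ : Module.Dual ℂ (Fin n → ℂ)) (x : Fin n → ℂ) :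
    contract δ (ι ℂ x) = algebraMap ℂ (E n) (δ x) :=
  CliffordAlgebra.contractLeft_ι _ δ x

lemma contract_ι_mul_ι (δ : Module.Dual ℂ (Fin n → ℂ)) (x y : Fin n → ℂ) :
    contract δ (ι ℂ x * ι ℂ y) = δ x • ι ℂ y - δ y • ι ℂ x := by
  rw [contract_ι_mul, contract_ι, ← Algebra.commutes, ← Algebra.smul_def]

/-- The span of the products `e k * e l` with `R k l`. -/
def quadricSpan (R : Fin n → Fin n → Prop) : Submodule ℂ (E n) :=
  Submodule.span ℂ {x | ∃ k l, R k l ∧ x = e k * e l}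

lemma ι_mul_ι_mem_quadricSpan {P Q : Fin n → Prop} {R : Fin n → Fin n → Prop} {f g : E n}
    (hf : f ∈ linearSpan P) (hg : g ∈ linearSpan Q) (h : ∀ k l, P k → Q l → R k l) :
    f * g ∈ quadricSpan R := by
  refine mul_mem_of_mem_span hf hg ?_
  rintro _ ⟨k, hk, rfl⟩ _ ⟨l, hl, rfl⟩
  exact Submodule.subset_span ⟨k, l, h k l hk hl, rfl⟩

lemma contract_quadric_eq_zero {R : Fin n → Fin n → Prop} {a : Fin n}
    (hR : ∀ k l, R k l → k ≠ a ∧ l ≠ a) {f : E n} (hf : f ∈ quadricSpan R) :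
    contract (LinearMap.proj a) f = 0 := by
  refine (Submodule.span_le (p := LinearMap.ker (contract (LinearMap.proj a)))).mpr ?_ hf
  rintro _ ⟨k, l, hkl, rfl⟩
  obtain ⟨hk, hl⟩ := hR k l hkl
  rw [SetLike.mem_coe, LinearMap.mem_ker, e, e, contract_ι_mul_ι]
  simp [Pi.single_eq_of_ne hk.symm, Pi.single_eq_of_ne hl.symm]

/-- A quadric annihilated by a nonzero linear form is divisible by it. -/
lemma exists_eq_ι_mul_ι {R : Fin n → Fin n → Prop} {f : E n} (hf : f ∈ quadricSpan R)
    {m : Fin n → ℂ} (hm : m ≠ 0) (h : ι ℂ m * f = 0) : ∃ r : Fin n → ℂ, f = ι ℂ m * ι ℂ r := by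
  obtain ⟨k, hk⟩ := Function.ne_iff.mp hm
  let δ : Module.Dual ℂ (Fin n → ℂ) := (m k)⁻¹ • LinearMap.proj k
  have hδ : δ m = 1 := by simp [δ, inv_mul_cancel₀ hk]
  have h1 := congrArg (contract δ) h
  rw [contract_ι_mul, hδ, one_smul, map_zero, sub_eq_zero] at h1
  have h2 : contract δ f ∈ LinearMap.range (ι ℂ : (Fin n → ℂ) →ₗ[ℂ] E n) := by
    refine (Submodule.span_le (p := (LinearMap.range (ι ℂ)).comap (contract δ))).mpr ?_ hf
    rintro _ ⟨k, l, -, rfl⟩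
    rw [SetLike.mem_coe, Submodule.mem_comap, e, e, contract_ι_mul_ι]
    exact sub_mem (Submodule.smul_mem _ _ ⟨_, rfl⟩) (Submodule.smul_mem _ _ ⟨_, rfl⟩)
  obtain ⟨r, hr⟩ := h2
  exact ⟨r, by rw [hr, ← h1]⟩

/-! ### The rank of a product of two linear forms -/

lemma ι_mul_ι_isQuadric (x y : Fin n → ℂ) : IsQuadric (ι ℂ x * ι ℂ y) := by
  rw [IsQuadric, ExteriorAlgebra.exteriorPower, pow_two]
  exact Submodule.mul_mem_mul ⟨x, rfl⟩ ⟨y, rfl⟩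

lemma ι_mul_ι_eq_sum (x y : Fin n → ℂ) :
    ι ℂ x * ι ℂ y = ∑ i, ∑ j, (x i * y j) • (e i * e j : E n) := by
  have h : ∀ z : Fin n → ℂ, ι ℂ z = ∑ i, z i • (e i : E n) := by
    intro z
    conv_lhs => rw [← (Pi.basisFun ℂ (Fin n)).sum_repr z, map_sum]
    simp [e]
  rw [h x, h y, Finset.sum_mul_sum]
  simp only [smul_mul_smul_comm]

lemma ι_mul_ι_hasRank {x y : Fin n → ℂ} {a c : Fin n} (h : x a * y c - x c * y a ≠ 0) :
    HasRank (ι ℂ x * ι ℂ y) 2 := by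
  let A : Matrix (Fin n) (Fin n) ℂ := Matrix.of fun i j => (x i * y j - x j * y i) / 2
  refine ⟨A, ⟨?_, ?_⟩, ?_, ?_⟩
  · ext i j
    simp only [A, Matrix.transpose_apply, Matrix.of_apply, Matrix.neg_apply]
    ring
  · intro i
    simp only [A, Matrix.of_apply]
    ring
  · have h1 : ∑ i, ∑ j, A i j • (e i * e j : E n) =
        (1 / 2 : ℂ) • (ι ℂ x * ι ℂ y - ι ℂ y * ι ℂ x) := by
      rw [ι_mul_ι_eq_sum, ι_mul_ι_eq_sum, ← Finset.sum_sub_distrib, Finset.smul_sum]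
      refine Finset.sum_congr rfl fun i _ => ?_
      rw [← Finset.sum_sub_distrib, Finset.smul_sum]
      refine Finset.sum_congr rfl fun j _ => ?_
      rw [← sub_smul, smul_smul]
      congr 1
      simp only [A, Matrix.of_apply]
      ring
    rw [h1, ι_mul_swap y x, sub_neg_eq_add, ← two_smul ℂ, smul_smul]
    norm_num
  · apply le_antisymm
    · have hA : A = Matrix.of (fun i (k : Fin 2) => if k = 0 then x i / 2 else - y i / 2) *
          Matrix.of (fun (k : Fin 2) j => if k = 0 then y j else x j) := by
        ext i j
        simp [A, Matrix.mul_apply, Fin.sum_univ_two]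
        ring
      rw [hA]
      refine (Matrix.rank_mul_le_left _ _).trans ((Matrix.rank_le_card_width _).trans ?_)
      simp
    · have hsub : (A.submatrix ![a, c] ![a, c]).rank = 2 := by
        have hdet : IsUnit (A.submatrix ![a, c] ![a, c]) := by
          rw [Matrix.isUnit_iff_isUnit_det, Matrix.det_fin_two, isUnit_iff_ne_zero]
          simp only [A, Matrix.submatrix_apply, Matrix.of_apply, Matrix.cons_val_zero,
            Matrix.cons_val_one]
          have : (x a * y a - x a * y a) / 2 * ((x c * y c - x c * y c) / 2) -
              (x a * y c - x c * y a) / 2 * ((x c * y a - x a * y c) / 2) =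
              ((x a * y c - x c * y a) / 2) ^ 2 := by ring
          rw [this]
          exact pow_ne_zero 2 (div_ne_zero h two_ne_zero)
        simpa using Matrix.rank_of_isUnit _ hdet
      rw [← hsub]
      exact Matrix.rank_submatrix_le _ _ _

/-! ### The smallest non-isolated vertex -/

section Smallest

variable {lt : Finset (Fin n) → Finset (Fin n) → Prop} {G : SimpleGraph (Fin n)} {I : Ideal (E n)}

lemma IsMonomialOrder.lt_of_pair_lt (hlt : IsMonomialOrder lt) {i j k : Fin n} (hij : i ≠ j)
    (hik : i ≠ k) (h : lt {i, j} {i, k}) : lt {j} {k} := by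
  by_contra hn
  have hjk : j ≠ k := by
    rintro rfl
    exact hlt.irrefl _ h
  have h1 := (hlt.total {j} {k} (by simpa using hjk)).resolve_left hn
  have h2 := hlt.mul_lt_mul _ _ {i} h1 (by simpa using hik.symm) (by simpa using hij.symm)
  rw [Finset.union_comm, Finset.union_comm {j}] at h2
  exact hlt.irrefl _ (hlt.trans _ _ _ h h2)

lemma IsMonomialOrder.pair_lt (hlt : IsMonomialOrder lt) {i j k : Fin n} (hij : i ≠ j)
    (hik : i ≠ k) (h : lt {j} {k}) : lt {i, j} {i, k} := by
  have h2 := hlt.mul_lt_mul _ _ {i} h (by simpa using hij.symm) (by simpa using hik.symm)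
  rw [Finset.union_comm, Finset.union_comm {k}] at h2
  exact h2

/-- A smallest non-isolated vertex with a single neighbour gives a product of two linear forms. -/
lemma exists_product_of_one_neighbor (hlt : IsMonomialOrder lt) (hI : IsGraded I)
    (hin : initialIdeal lt I = edgeIdeal G) {a b : Fin n} (hab : G.Adj a b)
    (hnbr : ∀ j, G.Adj a j → j = b) (hmin : ∀ j, lt {j} {a} → ∀ k, ¬ G.Adj j k) :
    ∃ x y : Fin n → ℂ, (∃ i j, x i * y j - x j * y i ≠ 0) ∧ ι ℂ x * ι ℂ y ∈ I := by
  obtain ⟨t, ht, hq⟩ := exists_reduced_quadric hlt hI hin hab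
  have hne := hab.ne
  let isol : Fin n → Prop := fun i => ∀ k, ¬ G.Adj i k
  let R : Fin n → Fin n → Prop := fun k l => ¬ G.Adj k l ∧ (k ≠ a ∧ l ≠ a) ∧ k ≠ b ∧ l ≠ b
  -- Sort the tail of the reduced quadric by the variables `e a` and `e b`.
  have htail : t ∈ Submodule.span ℂ {e a} * linearSpan (fun i => i ≠ a ∧ i ≠ b) ⊔
      (Submodule.span ℂ {e b} * linearSpan isol ⊔ quadricSpan R) := by
    refine Submodule.span_le.mpr ?_ ht
    have key : ∀ k l, k ≠ l → ¬ G.Adj k l → lt {k, l} {a, b} → (l = a → k = a) →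
        (k ≠ a → l = b → k = b) →
        e k * e l ∈ Submodule.span ℂ {e a} * linearSpan (fun i => i ≠ a ∧ i ≠ b) ⊔
          (Submodule.span ℂ {e b} * linearSpan isol ⊔ quadricSpan R) := by
      intro k l hkl hadj hl h1 h2
      by_cases hka : k = a
      · subst hka
        refine Submodule.mem_sup_left (Submodule.mul_mem_mul
          (Submodule.mem_span_singleton_self _) (e_mem_linearSpan ⟨hkl.symm, ?_⟩))
        rintro rfl
        exact hadj hab
      refine Submodule.mem_sup_right ?_
      by_cases hkb : k = b
      · subst hkb
        refine Submodule.mem_sup_left (Submodule.mul_mem_mul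
          (Submodule.mem_span_singleton_self _) (e_mem_linearSpan ?_))
        rw [Finset.pair_comm a] at hl
        exact hmin l (hlt.lt_of_pair_lt hkl hab.ne' hl)
      · exact Submodule.mem_sup_right (Submodule.subset_span
          ⟨k, l, ⟨hadj, ⟨hka, fun h => hka (h1 h)⟩, hkb, fun h => hkb (h2 hka h)⟩, rfl⟩)
    rintro _ ⟨k, l, hkl, hadj, hl, rfl⟩
    by_cases hc : (l = a → k = a) ∧ (k ≠ a → l = b → k = b)
    · exact key k l hkl hadj hl hc.1 hc.2
    · rw [e_mul_swap, SetLike.mem_coe]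
      refine neg_mem (key l k hkl.symm (fun h => hadj h.symm) (by rwa [Finset.pair_comm]) ?_ ?_)
      · grind
      · grind
  obtain ⟨t1, ht1, t2, ht2, rfl⟩ := Submodule.mem_sup.mp htail
  obtain ⟨t2, ht2', s, hs, rfl⟩ := Submodule.mem_sup.mp ht2
  obtain ⟨U, hU, rfl⟩ := Submodule.mem_span_singleton_mul.mp ht1
  obtain ⟨V, hV, rfl⟩ := Submodule.mem_span_singleton_mul.mp ht2'
  obtain ⟨u, rfl, hu⟩ := exists_ι_of_mem_linearSpan hU
  obtain ⟨v, rfl, hv⟩ := exists_ι_of_mem_linearSpan hV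
  have hva : v a = 0 := hv a fun h => h b hab
  have hvb : v b = 0 := hv b fun h => h a hab.symm
  have hua : u a = 0 := hu a (by simp)
  have hub : u b = 0 := hu b (by simp)
  set x : Fin n → ℂ := Pi.single a 1 - v with hx
  set y : Fin n → ℂ := Pi.single b 1 + u with hy
  have hxι : ι ℂ x = e a - ι ℂ v := by rw [hx, map_sub, e]
  have hyι : ι ℂ y = e b + ι ℂ u := by rw [hy, map_add, e]
  have hR : s + ι ℂ v * ι ℂ u ∈ quadricSpan R := by
    refine add_mem hs (ι_mul_ι_mem_quadricSpan hV hU ?_)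
    rintro k l hk ⟨hl, hl'⟩
    refine ⟨hk l, ⟨?_, hl⟩, ?_, hl'⟩
    · rintro rfl; exact hk b hab
    · rintro rfl; exact hk a hab.symm
  set s1 := s + ι ℂ v * ι ℂ u with hs1
  have hq1 : e a * e b + (e a * ι ℂ u + (e b * ι ℂ v + s)) = ι ℂ x * ι ℂ y + s1 := by
    have : e b * ι ℂ v = -(ι ℂ v * e b) := ι_mul_swap _ _
    rw [hxι, hyι, this, hs1]
    noncomm_ring
  rw [hq1] at hq
  have hzero : ι ℂ x * s1 = 0 := by
    refine eq_zero_of_mem_of_indep hlt hin (?_ : ι ℂ x * s1 ∈ I) ?_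
    · have := I.mul_mem_left (ι ℂ x) hq
      rwa [mul_add, ← mul_assoc, ExteriorAlgebra.ι_sq_zero, zero_mul, zero_add] at this
    · rw [hxι, sub_mul]
      refine sub_mem ?_ ?_
      · refine mul_mem_of_mem_span (Submodule.mem_span_singleton_self _) hR ?_
        rintro _ rfl _ ⟨k, l, ⟨h1, -, h3, h4⟩, rfl⟩
        exact e_mul_e_mul_e_mem_indep (fun h => h3 (hnbr k h)) (fun h => h4 (hnbr l h)) h1
      · refine mul_mem_of_mem_span hV hR ?_
        rintro _ ⟨i, hi, rfl⟩ _ ⟨k, l, ⟨h1, -⟩, rfl⟩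
        exact e_mul_e_mul_e_mem_indep (hi k) (hi l) h1
  have hs0 : s1 = 0 := by
    have := congrArg (contract (LinearMap.proj a)) hzero
    rw [contract_ι_mul, contract_quadric_eq_zero (fun k l h => h.2.1) hR] at this
    simpa [hx, hva] using this
  refine ⟨x, y, ⟨a, b, ?_⟩, ?_⟩
  · simp [hx, hy, hva, hvb, hua, hub, hne, hne.symm]
  · rwa [hs0, add_zero] at hq

/-- The shape of the tail of the reduced quadric of the edge `a b`, where `a` is the smallest
non-isolated vertex and `b` the smaller of its two neighbours `b` and `c`: a variable that occurs in
it together with `e b` or `e c` is smaller than `e a`, hence isolated. -/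
lemma tail_of_smallest_edge (hlt : IsMonomialOrder lt) {a b c : Fin n} (hab : G.Adj a b)
    (hac : G.Adj a c) (hbc : lt {b} {c}) (hmin : ∀ j, lt {j} {a} → ∀ k, ¬ G.Adj j k) {t : E n}
    (ht : t ∈ Submodule.span ℂ {x : E n | ∃ k l, k ≠ l ∧ ¬ G.Adj k l ∧ lt {k, l} {a, b} ∧
      x = e k * e l}) :
    ∃ u v m : Fin n → ℂ, ∃ s ∈ quadricSpan (fun k l => ¬ G.Adj k l ∧ (k ≠ a ∧ l ≠ a) ∧
        (k ≠ b ∧ l ≠ b) ∧ k ≠ c ∧ l ≠ c),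
      (∀ i, ¬ (i ≠ a ∧ i ≠ b ∧ i ≠ c) → u i = 0) ∧ (∀ i, ¬ (∀ k, ¬ G.Adj i k) → v i = 0) ∧
      (∀ i, ¬ (∀ k, ¬ G.Adj i k) → m i = 0) ∧
      t = e a * ι ℂ u + (e b * ι ℂ v + (ι ℂ m * e c + s)) := by
  let isol : Fin n → Prop := fun i => ∀ k, ¬ G.Adj i k
  let X : Fin n → Prop := fun i => i ≠ a ∧ i ≠ b ∧ i ≠ c
  let R : Fin n → Fin n → Prop := fun k l => ¬ G.Adj k l ∧ (k ≠ a ∧ l ≠ a) ∧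
    (k ≠ b ∧ l ≠ b) ∧ k ≠ c ∧ l ≠ c
  have hbc' : b ≠ c := by
    rintro rfl
    exact hlt.irrefl _ hbc
  let W : Submodule ℂ (E n) := Submodule.span ℂ {e a} * linearSpan X ⊔
    (Submodule.span ℂ {e b} * linearSpan isol ⊔
      (linearSpan isol * Submodule.span ℂ {e c} ⊔ quadricSpan R))
  have hW : t ∈ W := by
    refine Submodule.span_le.mpr ?_ ht
    have key : ∀ k l, k ≠ l → ¬ G.Adj k l → lt {k, l} {a, b} → (l = a → k = a) →
        (k ≠ a → l = b → k = b) → (k ≠ a → k ≠ b → k = c → l = c) → e k * e l ∈ W := by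
      intro k l hkl hadj hl h1 h2 h3
      by_cases hka : k = a
      · subst hka
        refine Submodule.mem_sup_left (Submodule.mul_mem_mul
          (Submodule.mem_span_singleton_self _) (e_mem_linearSpan ⟨hkl.symm, ?_, ?_⟩))
        · rintro rfl; exact hadj hab
        · rintro rfl; exact hadj hac
      refine Submodule.mem_sup_right ?_
      by_cases hkb : k = b
      · subst hkb
        refine Submodule.mem_sup_left (Submodule.mul_mem_mul
          (Submodule.mem_span_singleton_self _) (e_mem_linearSpan ?_))
        rw [Finset.pair_comm a] at hl
        exact hmin l (hlt.lt_of_pair_lt hkl hab.ne' hl)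
      refine Submodule.mem_sup_right ?_
      have hlb : l ≠ b := fun h => hkb (h2 hka h)
      by_cases hlc : l = c
      · subst hlc
        refine Submodule.mem_sup_left (Submodule.mul_mem_mul
          (e_mem_linearSpan ?_) (Submodule.mem_span_singleton_self _))
        -- `e b * e k < e c * e k < e a * e b` forces `e k < e a`.
        have h4 := hlt.trans _ _ _ (hlt.pair_lt hkb hkl hbc) hl
        rw [Finset.pair_comm a, Finset.pair_comm k] at h4
        exact hmin k (hlt.lt_of_pair_lt (Ne.symm hkb) hab.ne' h4)
      · exact Submodule.mem_sup_right (Submodule.subset_span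
          ⟨k, l, ⟨hadj, ⟨hka, fun h => hka (h1 h)⟩, ⟨hkb, hlb⟩,
            fun h => hlc (h3 hka hkb h), hlc⟩, rfl⟩)
    rintro _ ⟨k, l, hkl, hadj, hl, rfl⟩
    by_cases hc : (l = a → k = a) ∧ (k ≠ a → l = b → k = b) ∧ (k ≠ a → k ≠ b → k = c → l = c)
    · exact key k l hkl hadj hl hc.1 hc.2.1 hc.2.2
    · by_cases hc' : (k = a → l = a) ∧ (l ≠ a → k = b → l = b) ∧ (l ≠ a → l ≠ b → l = c → k = c)
      · rw [e_mul_swap, SetLike.mem_coe]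
        exact neg_mem (key l k hkl.symm (fun h => hadj h.symm) (by rwa [Finset.pair_comm])
          hc'.1 hc'.2.1 hc'.2.2)
      · -- What remains is `e b * e c`, which would give `e c < e a`.
        exfalso
        have hca : ¬ lt {c} {a} := fun h => hmin c h a hac.symm
        have h5 : ({k, l} : Finset (Fin n)) = {b, c} := by
          have := hab.ne
          have := hac.ne
          have : (k = b ∧ l = c) ∨ (k = c ∧ l = b) := by grind
          rcases this with ⟨rfl, rfl⟩ | ⟨rfl, rfl⟩
          · rfl
          · exact Finset.pair_comm _ _
        rw [h5, Finset.pair_comm a] at hl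
        exact hca (hlt.lt_of_pair_lt hbc' hab.ne' hl)
  obtain ⟨t1, ht1, t2, ht2, rfl⟩ := Submodule.mem_sup.mp hW
  obtain ⟨t2, ht2', t3, ht3, rfl⟩ := Submodule.mem_sup.mp ht2
  obtain ⟨t3, ht3', s, hs, rfl⟩ := Submodule.mem_sup.mp ht3
  obtain ⟨U, hU, rfl⟩ := Submodule.mem_span_singleton_mul.mp ht1
  obtain ⟨V, hV, rfl⟩ := Submodule.mem_span_singleton_mul.mp ht2'
  obtain ⟨M, hM, rfl⟩ := Submodule.mem_mul_span_singleton.mp ht3'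
  obtain ⟨u, rfl, hu⟩ := exists_ι_of_mem_linearSpan hU
  obtain ⟨v, rfl, hv⟩ := exists_ι_of_mem_linearSpan hV
  obtain ⟨m, rfl, hm⟩ := exists_ι_of_mem_linearSpan hM
  exact ⟨u, v, m, s, hs, hu, hv, hm, rfl⟩

/-- The part of the tail of a reduced quadric of an edge at `a` that involves `e a`. -/
lemma tail_of_edge {a b c : Fin n} (hab : G.Adj a b) (hac : G.Adj a c) {S : Finset (Fin n)}
    {t : E n} (ht : t ∈ Submodule.span ℂ {x : E n | ∃ k l, k ≠ l ∧ ¬ G.Adj k l ∧ lt {k, l} S ∧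
      x = e k * e l}) :
    ∃ p : Fin n → ℂ, ∃ s ∈ quadricSpan (fun k l => ¬ G.Adj k l ∧ k ≠ a ∧ l ≠ a),
      (∀ i, ¬ (i ≠ a ∧ i ≠ b ∧ i ≠ c) → p i = 0) ∧ t = e a * ι ℂ p + s := by
  let X : Fin n → Prop := fun i => i ≠ a ∧ i ≠ b ∧ i ≠ c
  have hW : t ∈ Submodule.span ℂ {e a} * linearSpan X ⊔
      quadricSpan (fun k l => ¬ G.Adj k l ∧ k ≠ a ∧ l ≠ a) := by
    refine Submodule.span_le.mpr ?_ ht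
    have hX : ∀ l, l ≠ a → ¬ G.Adj a l → e a * e l ∈ Submodule.span ℂ {e a} * linearSpan X := by
      intro l hla hadj
      refine Submodule.mul_mem_mul (Submodule.mem_span_singleton_self _)
        (e_mem_linearSpan ⟨hla, ?_, ?_⟩)
      · rintro rfl; exact hadj hab
      · rintro rfl; exact hadj hac
    rintro _ ⟨k, l, hkl, hadj, -, rfl⟩
    by_cases hka : k = a
    · subst hka
      exact Submodule.mem_sup_left (hX l hkl.symm hadj)
    by_cases hla : l = a
    · subst hla
      rw [e_mul_swap, SetLike.mem_coe]
      exact Submodule.mem_sup_left (neg_mem (hX k hkl fun h => hadj h.symm))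
    · exact Submodule.mem_sup_right (Submodule.subset_span ⟨k, l, ⟨hadj, hka, hla⟩, rfl⟩)
  obtain ⟨t1, ht1, s, hs, rfl⟩ := Submodule.mem_sup.mp hW
  obtain ⟨P, hP, rfl⟩ := Submodule.mem_span_singleton_mul.mp ht1
  obtain ⟨p, rfl, hp⟩ := exists_ι_of_mem_linearSpan hP
  exact ⟨p, s, hs, hp, rfl⟩

lemma smul_mem_ideal {f : E n} (hf : f ∈ I) (c : ℂ) : c • f ∈ I := by
  rw [Algebra.smul_def]
  exact I.mul_mem_left _ hf

/-- A smallest non-isolated vertex with two neighbours gives a product of two linear forms: the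
quadrics of the two edges at that vertex are, in suitable linear forms `x, y, z, m, r`, equal to
`x * y + m * z` and `x * z + m * r`, with `r` in the span of `x, y, z, m`, and some member of the
pencil that they span is a product. -/
lemma exists_product_of_two_neighbors (hlt : IsMonomialOrder lt) (hI : IsGraded I)
    (hin : initialIdeal lt I = edgeIdeal G) {a b c : Fin n} (hab : G.Adj a b) (hac : G.Adj a c)
    (hbc : lt {b} {c}) (hnbr : ∀ j, G.Adj a j → j = b ∨ j = c)
    (hmin : ∀ j, lt {j} {a} → ∀ k, ¬ G.Adj j k) :
    ∃ x y : Fin n → ℂ, (∃ i j, x i * y j - x j * y i ≠ 0) ∧ ι ℂ x * ι ℂ y ∈ I := by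
  obtain ⟨t, ht, hq⟩ := exists_reduced_quadric hlt hI hin hab
  obtain ⟨t', ht', hq'⟩ := exists_reduced_quadric hlt hI hin hac
  obtain ⟨u, v, m, s, hs, hu, hv, hm, rfl⟩ := tail_of_smallest_edge hlt hab hac hbc hmin ht
  obtain ⟨p, φ, hφ, hp, ht'eq⟩ := tail_of_edge hab hac ht'
  have hbc' : b ≠ c := by
    rintro rfl
    exact hlt.irrefl _ hbc
  have hab' := hab.ne
  have hac' := hac.ne
  let isol : Fin n → Prop := fun i => ∀ k, ¬ G.Adj i k
  let R : Fin n → Fin n → Prop := fun k l => ¬ G.Adj k l ∧ (k ≠ a ∧ l ≠ a) ∧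
    (k ≠ b ∧ l ≠ b) ∧ k ≠ c ∧ l ≠ c
  have hva : v a = 0 := hv a fun h => h b hab
  have hvb : v b = 0 := hv b fun h => h a hab.symm
  have hvc : v c = 0 := hv c fun h => h a hac.symm
  have hma : m a = 0 := hm a fun h => h b hab
  have hmb : m b = 0 := hm b fun h => h a hab.symm
  have hmc : m c = 0 := hm c fun h => h a hac.symm
  have hua : u a = 0 := hu a (by simp)
  have hub : u b = 0 := hu b (by simp)
  have huc : u c = 0 := hu c (by simp)
  have hpa : p a = 0 := hp a (by simp)
  have hpb : p b = 0 := hp b (by simp)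
  have hpc : p c = 0 := hp c (by simp)
  have hV : ι ℂ v ∈ linearSpan isol := ι_mem_linearSpan hv
  have hM : ι ℂ m ∈ linearSpan isol := ι_mem_linearSpan hm
  have hU := ι_mem_linearSpan hu
  have hP := ι_mem_linearSpan hp
  -- Completing the square.
  set x : Fin n → ℂ := Pi.single a 1 - v with hx
  set y : Fin n → ℂ := Pi.single b 1 + u with hy
  set z : Fin n → ℂ := Pi.single c 1 + p with hz
  have hxι : ι ℂ x = e a - ι ℂ v := by rw [hx, map_sub, e]
  have hyι : ι ℂ y = e b + ι ℂ u := by rw [hy, map_add, e]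
  have hzι : ι ℂ z = e c + ι ℂ p := by rw [hz, map_add, e]
  have hxa : x a = 1 := by simp [hx, hva]
  have hxb : x b = 0 := by simp [hx, hvb, hab'.symm]
  have hxc : x c = 0 := by simp [hx, hvc, hac'.symm]
  have hya : y a = 0 := by simp [hy, hua, hab']
  have hyb : y b = 1 := by simp [hy, hub]
  have hyc : y c = 0 := by simp [hy, huc, hbc'.symm]
  have hza : z a = 0 := by simp [hz, hpa, hac']
  have hzb : z b = 0 := by simp [hz, hpb, hbc']
  have hzc : z c = 1 := by simp [hz, hpc]
  have hR : s + ι ℂ v * ι ℂ u ∈ quadricSpan R := by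
    refine add_mem hs (ι_mul_ι_mem_quadricSpan hV hU ?_)
    rintro k l hk ⟨hla, hlb, hlc⟩
    refine ⟨hk l, ⟨?_, hla⟩, ⟨?_, hlb⟩, ?_, hlc⟩
    · rintro rfl; exact hk b hab
    · rintro rfl; exact hk a hab.symm
    · rintro rfl; exact hk a hac.symm
  set s1 := s + ι ℂ v * ι ℂ u with hs1
  set ψ := φ + ι ℂ v * ι ℂ p + ι ℂ v * e c with hψ
  have hψR : ψ ∈ quadricSpan (fun k l => k ≠ a ∧ l ≠ a) := by
    have hisol : ∀ i, isol i → i ≠ a := by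
      rintro i hi rfl
      exact hi b hab
    refine add_mem (add_mem ?_ ?_) ?_
    · refine Submodule.span_mono ?_ hφ
      rintro _ ⟨k, l, h, rfl⟩
      exact ⟨k, l, h.2, rfl⟩
    · exact ι_mul_ι_mem_quadricSpan hV hP fun k l hk hl => ⟨hisol k hk, hl.1⟩
    · exact ι_mul_ι_mem_quadricSpan hV (e_mem_linearSpan (P := fun i => i ≠ a) hac'.symm)
        fun k l hk hl => ⟨hisol k hk, hl⟩
  have hq1 : e a * e b + (e a * ι ℂ u + (e b * ι ℂ v + (ι ℂ m * e c + s))) =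
      ι ℂ x * ι ℂ y + (ι ℂ m * e c + s1) := by
    have : e b * ι ℂ v = -(ι ℂ v * e b) := ι_mul_swap _ _
    rw [hxι, hyι, this, hs1]
    noncomm_ring
  rw [hq1] at hq
  have hq1' : e a * e c + t' = ι ℂ x * ι ℂ z + ψ := by
    rw [ht'eq, hxι, hzι, hψ]
    noncomm_ring
  -- The linear syzygy between the two quadrics.
  have hsyz : ι ℂ x * (s1 - ι ℂ m * ι ℂ p) + ι ℂ m * ψ = 0 := by
    have hxx : ι ℂ x * ι ℂ x = 0 := ExteriorAlgebra.ι_sq_zero _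
    have hxm : ι ℂ x * ι ℂ m = -(ι ℂ m * ι ℂ x) := ι_mul_swap _ _
    have h1 : ι ℂ x * (s1 - ι ℂ m * ι ℂ p) + ι ℂ m * ψ =
        ι ℂ x * (ι ℂ x * ι ℂ y + (ι ℂ m * e c + s1)) + ι ℂ m * (e a * e c + t') := by
      have e1 : ι ℂ x * (ι ℂ x * ι ℂ y + (ι ℂ m * e c + s1)) =
          ι ℂ x * ι ℂ x * ι ℂ y + ι ℂ x * ι ℂ m * e c + ι ℂ x * s1 := by noncomm_ring
      have e2 : ι ℂ x * (s1 - ι ℂ m * ι ℂ p) = ι ℂ x * s1 - ι ℂ x * ι ℂ m * ι ℂ p := by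
        noncomm_ring
      rw [hq1', e1, e2, hxx, hxm, hzι]
      noncomm_ring
    have h2 : ι ℂ x * (s1 - ι ℂ m * ι ℂ p) + ι ℂ m * ψ =
        e a * s1 - ι ℂ v * s1 - ι ℂ v * (ι ℂ m * e c) + ι ℂ m * t' := by
      have ham : e a * ι ℂ m = -(ι ℂ m * e a) := ι_mul_swap _ _
      have hvm : ι ℂ v * ι ℂ m = -(ι ℂ m * ι ℂ v) := ι_mul_swap _ _
      have e2 : ι ℂ x * (s1 - ι ℂ m * ι ℂ p) = e a * s1 - ι ℂ v * s1
          - e a * ι ℂ m * ι ℂ p + ι ℂ v * ι ℂ m * ι ℂ p := by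
        rw [hxι]; noncomm_ring
      rw [e2, ← mul_assoc (ι ℂ v), ht'eq, hψ, ham, hvm]
      noncomm_ring
    refine eq_zero_of_mem_of_indep hlt hin ?_ ?_
    · rw [h1]
      exact add_mem (I.mul_mem_left _ hq) (I.mul_mem_left _ hq')
    · rw [h2]
      refine add_mem (sub_mem (sub_mem ?_ ?_) ?_) ?_
      · refine mul_mem_of_mem_span (Submodule.mem_span_singleton_self _) hR ?_
        rintro _ rfl _ ⟨k, l, ⟨h1, -, h3, h4⟩, rfl⟩
        refine e_mul_e_mul_e_mem_indep (fun h => ?_) (fun h => ?_) h1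
        · exact (hnbr k h).elim h3.1 h4.1
        · exact (hnbr l h).elim h3.2 h4.2
      · refine mul_mem_of_mem_span hV hR ?_
        rintro _ ⟨i, hi, rfl⟩ _ ⟨k, l, ⟨h1, -⟩, rfl⟩
        exact e_mul_e_mul_e_mem_indep (hi k) (hi l) h1
      · refine mul_mul_mem_of_mem_span hV hM (Submodule.mem_span_singleton_self _) ?_
        rintro _ ⟨i, hi, rfl⟩ _ ⟨j, hj, rfl⟩ _ rfl
        exact e_mul_e_mul_e_mem_indep (hi j) (hi c) (hj c)
      · refine mul_mem_of_mem_span hM ht' ?_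
        rintro _ ⟨i, hi, rfl⟩ _ ⟨k, l, -, hkl, -, rfl⟩
        exact e_mul_e_mul_e_mem_indep (hi k) (hi l) hkl
  have hmψ0 : contract (LinearMap.proj a) (ι ℂ m * ψ) = 0 := by
    rw [contract_ι_mul, contract_quadric_eq_zero (fun k l h => h) hψR]
    simp [hma]
  -- The variable `e a` occurs only in `x`, so both summands of the syzygy vanish.
  have hs1' : s1 = ι ℂ m * ι ℂ p := by
    have h0 : contract (LinearMap.proj a) (s1 - ι ℂ m * ι ℂ p) = 0 := by
      rw [map_sub, contract_quadric_eq_zero (fun k l h => h.2.1) hR, contract_ι_mul_ι]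
      simp [hma, hpa]
    have h1 := congrArg (contract (LinearMap.proj a)) hsyz
    rw [map_add, hmψ0, contract_ι_mul, h0, map_zero, mul_zero, sub_zero, add_zero,
      LinearMap.proj_apply, hxa, one_smul] at h1
    exact sub_eq_zero.mp h1
  have hmψ : ι ℂ m * ψ = 0 := by
    rw [hs1', sub_self, mul_zero, zero_add] at hsyz
    exact hsyz
  have hq2 : ι ℂ x * ι ℂ y + ι ℂ m * ι ℂ z ∈ I := by
    rw [hs1', ← mul_add, ← hzι] at hq
    exact hq
  rw [hq1'] at hq'
  by_cases hm0 : m = 0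
  · refine ⟨x, y, ⟨a, b, by simp [hxa, hxb, hyb]⟩, ?_⟩
    simpa [hm0] using hq2
  obtain ⟨r, hr⟩ := exists_eq_ι_mul_ι hψR hm0 hmψ
  rw [hr] at hq'
  -- Modulo `y` and `z`, the linear form `r` becomes free of `e b` and `e c`.
  set r0 : Fin n → ℂ := r - r b • y - r c • z with hr0
  have hr0ι : ι ℂ r = ι ℂ r0 + r b • ι ℂ y + r c • ι ℂ z := by
    rw [hr0, map_sub, map_sub, map_smul, map_smul]
    abel
  have hr0mem : ι ℂ r0 ∈ linearSpan (fun i => i ≠ b ∧ i ≠ c) := by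
    refine ι_mem_linearSpan fun i hi => ?_
    have : i = b ∨ i = c := by tauto
    rcases this with rfl | rfl
    · simp [hr0, hyb, hzb]
    · simp [hr0, hyc, hzc]
  have hmm : ι ℂ m * ι ℂ m = 0 := ExteriorAlgebra.ι_sq_zero _
  have hxx : ι ℂ x * ι ℂ x = 0 := ExteriorAlgebra.ι_sq_zero _
  have hxm : ι ℂ x * ι ℂ m = -(ι ℂ m * ι ℂ x) := ι_mul_swap _ _
  have hxmr : ι ℂ x * (ι ℂ m * ι ℂ r0) = 0 := by
    refine eq_zero_of_mem_of_indep hlt hin ?_ ?_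
    · have h1 : ι ℂ x * (ι ℂ m * ι ℂ r0) = ι ℂ x * (ι ℂ x * ι ℂ z + ι ℂ m * ι ℂ r) +
          r b • (ι ℂ m * (ι ℂ x * ι ℂ y + ι ℂ m * ι ℂ z)) +
          r c • (ι ℂ m * (ι ℂ x * ι ℂ z + ι ℂ m * ι ℂ r)) := by
        have e1 : ∀ w w' : E n, ι ℂ m * (w + ι ℂ m * w') = ι ℂ m * w := by
          intro w w'
          rw [mul_add, ← mul_assoc, hmm, zero_mul, add_zero]
        have e2 : ∀ w w' : E n, ι ℂ x * (ι ℂ x * w + w') = ι ℂ x * w' := by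
          intro w w'
          rw [mul_add, ← mul_assoc, hxx, zero_mul, zero_add]
        rw [e1, e1, e2, hr0ι]
        simp only [mul_add, mul_smul_comm, ← mul_assoc, hxm, neg_mul, smul_neg]
        abel
      rw [h1]
      exact add_mem (add_mem (I.mul_mem_left _ hq') (smul_mem_ideal (I.mul_mem_left _ hq2) _))
        (smul_mem_ideal (I.mul_mem_left _ hq') _)
    · rw [hxι, sub_mul]
      refine sub_mem ?_ ?_
      · refine mul_mul_mem_of_mem_span (Submodule.mem_span_singleton_self _) hM hr0mem ?_
        rintro _ rfl _ ⟨i, hi, rfl⟩ _ ⟨j, hj, rfl⟩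
        exact e_mul_e_mul_e_mem_indep (fun h => hi a h.symm)
          (fun h => (hnbr j h).elim hj.1 hj.2) (hi j)
      · refine mul_mul_mem_of_mem_span hV hM hr0mem ?_
        rintro _ ⟨i, hi, rfl⟩ _ ⟨j, hj, rfl⟩ _ ⟨k, hk, rfl⟩
        exact e_mul_e_mul_e_mem_indep (hi j) (hi k) (hj k)
  have hmr : ι ℂ m * ι ℂ r0 = -(r0 a) • (ι ℂ x * ι ℂ m) := by
    have h1 := congrArg (contract (LinearMap.proj a)) hxmr
    rw [contract_ι_mul, contract_ι_mul_ι, map_zero] at h1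
    simp only [LinearMap.proj_apply, hxa, hma, one_smul, zero_smul, zero_sub, mul_neg,
      mul_smul_comm, sub_neg_eq_add] at h1
    rw [neg_smul]
    exact eq_neg_of_add_eq_zero_left h1
  -- A root of `T ^ 2 + r c * T - r b` gives the member of the pencil that is a product.
  obtain ⟨d, hd⟩ := IsAlgClosed.exists_eq_mul_self (r c ^ 2 + 4 * r b)
  obtain ⟨L, hL⟩ : ∃ L : ℂ, r b = (r c + L) * L := by
    refine ⟨(d - r c) / 2, ?_⟩
    linear_combination (1 / 4 : ℂ) * hd
  refine ⟨x + (r c + L) • m, z + L • y - r0 a • m, ⟨a, c, ?_⟩, ?_⟩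
  · simp [hxa, hxc, hza, hzc, hya, hyc, hma, hmc]
  · have h1 : ι ℂ (x + (r c + L) • m) * ι ℂ (z + L • y - r0 a • m) =
        (ι ℂ x * ι ℂ z + ι ℂ m * ι ℂ r) + L • (ι ℂ x * ι ℂ y + ι ℂ m * ι ℂ z) := by
      rw [hr0ι, mul_add (ι ℂ m), mul_add (ι ℂ m), hmr, hL]
      simp only [map_add, map_sub, map_smul, add_mul, mul_add, mul_sub, mul_smul_comm,
        smul_mul_assoc, hmm, smul_zero]
      module
    rw [h1]
    exact add_mem hq' (smul_mem_ideal hq2 _)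

/-- If every vertex of `G` has at most two neighbours and `G` has an edge, then `I` contains a
product of two linearly independent linear forms. -/
lemma exists_product (hlt : IsMonomialOrder lt) (hI : IsGraded I)
    (hin : initialIdeal lt I = edgeIdeal G) (hedge : ∃ i j, G.Adj i j)
    (hdeg : ∀ i, ∃ b c, ∀ j, G.Adj i j → j = b ∨ j = c) :
    ∃ x y : Fin n → ℂ, (∃ i j, x i * y j - x j * y i ≠ 0) ∧ ι ℂ x * ι ℂ y ∈ I := by
  have wf : WellFounded fun i j : Fin n => lt {i} {j} := InvImage.wf _ hlt.wellFounded
  obtain ⟨a, ⟨j, haj⟩, hmin⟩ := wf.has_min {i | ∃ j, G.Adj i j} hedge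
  have hmin' : ∀ j, lt {j} {a} → ∀ k, ¬ G.Adj j k := fun j hj k hk => hmin j ⟨k, hk⟩ hj
  by_cases hone : ∃ b, ∀ j, G.Adj a j → j = b
  · obtain ⟨b, hb⟩ := hone
    obtain rfl := hb j haj
    exact exists_product_of_one_neighbor hlt hI hin haj hb hmin'
  obtain ⟨b, c, hbc⟩ := hdeg a
  push Not at hone
  obtain ⟨k, hk, hkb⟩ := hone b
  obtain ⟨l, hl, hlc⟩ := hone c
  obtain rfl := (hbc k hk).resolve_left hkb
  obtain rfl := (hbc l hl).resolve_right hlc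
  rcases hlt.total {l} {k} (by simpa using hlc) with h | h
  · exact exists_product_of_two_neighbors hlt hI hin hl hk h hbc hmin'
  · exact exists_product_of_two_neighbors hlt hI hin hk hl h (fun j hj => (hbc j hj).symm) hmin'

end Smallest

/-! ### The three graphs -/

/-- There is an edge, and every vertex has at most two neighbours: the maximal degree is one or
two. -/
def HasMaxDegreeTwo {V : Type*} (G : SimpleGraph V) : Prop :=
  (∃ i j, G.Adj i j) ∧ ∀ i, ∃ b c, ∀ j, G.Adj i j → j = b ∨ j = c

lemma HasMaxDegreeTwo.of_iso {V W : Type*} {G : SimpleGraph V} {H : SimpleGraph W} (f : G ≃g H)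
    (h : HasMaxDegreeTwo H) : HasMaxDegreeTwo G := by
  obtain ⟨⟨i, j, hij⟩, h2⟩ := h
  refine ⟨⟨f.symm i, f.symm j, f.symm.map_adj_iff.mpr hij⟩, fun i => ?_⟩
  obtain ⟨b, c, hbc⟩ := h2 (f i)
  refine ⟨f.symm b, f.symm c, fun j hj => ?_⟩
  rcases hbc (f j) (f.map_adj_iff.mpr hj) with h | h
  · left; rw [← h]; simp
  · right; rw [← h]; simp

lemma HasMaxDegreeTwo.sum {V W : Type*} {G : SimpleGraph V} {H : SimpleGraph W}
    (hG : HasMaxDegreeTwo G) (hH : ∀ i, ∃ b c, ∀ j, H.Adj i j → j = b ∨ j = c) :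
    HasMaxDegreeTwo (G ⊕g H) := by
  obtain ⟨⟨i, j, hij⟩, h2⟩ := hG
  refine ⟨⟨Sum.inl i, Sum.inl j, by simpa using hij⟩, ?_⟩
  rintro (i | i)
  · obtain ⟨b, c, hbc⟩ := h2 i
    refine ⟨Sum.inl b, Sum.inl c, ?_⟩
    rintro (j | j) hj
    · simpa using hbc j (by simpa using hj)
    · simp at hj
  · obtain ⟨b, c, hbc⟩ := hH i
    refine ⟨Sum.inr b, Sum.inr c, ?_⟩
    rintro (j | j) hj
    · simp at hj
    · simpa using hbc j (by simpa using hj)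

lemma hasMaxDegreeTwo_cycleGraph_three : HasMaxDegreeTwo (SimpleGraph.cycleGraph 3) := by
  unfold HasMaxDegreeTwo
  decide

lemma hasMaxDegreeTwo_pathGraph_four : HasMaxDegreeTwo (SimpleGraph.pathGraph 4) := by
  unfold HasMaxDegreeTwo
  simp only [SimpleGraph.pathGraph_adj]
  decide

lemma IsOneOfThree.hasMaxDegreeTwo {G : SimpleGraph (Fin n)} (h : IsOneOfThree G) :
    HasMaxDegreeTwo G := by
  have hbot : ∀ m : ℕ, ∀ i : Fin m, ∃ b c, ∀ j, (⊥ : SimpleGraph (Fin m)).Adj i j →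
      j = b ∨ j = c := fun m i => ⟨i, i, fun j hj => by simp at hj⟩
  have h3 := hasMaxDegreeTwo_cycleGraph_three
  have h4 := hasMaxDegreeTwo_pathGraph_four
  rcases h with ⟨m, ⟨f⟩⟩ | ⟨m, ⟨f⟩⟩ | ⟨m, ⟨f⟩⟩
  · exact .of_iso f ((h3.sum h3.2).sum (hbot m))
  · exact .of_iso f ((h3.sum h4.2).sum (hbot m))
  · exact .of_iso f ((h4.sum h4.2).sum (hbot m))

end ExtEdge
end

theorem mainTheorem6 (n : ℕ) (G : SimpleGraph (Fin n)) (hG : ExtEdge.IsOneOfThree G)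
    (I : Ideal (ExtEdge.E n)) (hI : ExtEdge.IsGraded I)
    (lt : Finset (Fin n) → Finset (Fin n) → Prop) (hlt : ExtEdge.IsMonomialOrder lt)
    (hin : ExtEdge.initialIdeal lt I = ExtEdge.edgeIdeal G) :
    ∃ q ∈ I, ExtEdge.IsQuadric q ∧ ExtEdge.HasRank q 2 := by
  obtain ⟨hedge, hdeg⟩ := hG.hasMaxDegreeTwo
  obtain ⟨x, y, ⟨i, j, hij⟩, hmem⟩ := ExtEdge.exists_product hlt hI hin hedge hdeg
  exact ⟨_, hmem, ExtEdge.ι_mul_ι_isQuadric x y, ExtEdge.ι_mul_ι_hasRank hij⟩
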